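/- Let $\mathbb D=\{z\in\mathbb C:|z|<1\}$, $d\mathrm{vol}_H=(1-|z|^2)^{-2}\,dx\,dy$, and let $M_D$ be the group of maps $m(z)=e^{i\theta}\frac{z-a}{1-\bar a z}$ ($|a|<1$, $\theta\in\mathbb R$). For $z_0\in\mathbb D$ and $R>0$ let $\Omega_{z_0,R}=\{z\in\mathbb D: |(z-z_0)/(1-\bar z_0z)|\le\tanh R\}$ be the hyperbolic disk of radius $R$ around $z_0$. A disk-type surface $\mathcal M=(\mathbb D,\mu)$ is the disk $\mathbb D$ with the Riemannian metric $\mu(z)(1-|z|^2)^{-2}(dx^2+dy^2)$, where the conformal factor $\mu:\mathbb D\to(0,\infty)$ is continuous and the area is normalized to $\int_{\mathbb D}\mu\,d\mathrm{vol}_H=1$. For two such surfaces $\mathcal M=(\mathbb D,\mu)$, $\mathcal N=(\mathbb D,\nu)$ put $$d^R_{\mu,\nu}(z_0,w_0)=\inf_{m\in M_D,\ m(z_0)=w_0}\int_{\Omega_{z_0,R}}|\mu(z)-\nu(m(z))|\,d\mathrm{vol}_H(z),\qquad \mathbf d^R(\mathcal M,\mathcal N)=\inf_{\pi\in\Pi(\mu,\nu)}\int_{\mathbb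 D\times\mathbb D}d^R_{\mu,\nu}(z,w)\,d\pi(z,w),$$ where $\Pi(\mu,\nu)$ is the set of Borel measures on $\mathbb D\times\mathbb D$ with marginals the area measures $\mu\,d\mathrm{vol}_H$ and $\nu\,d\mathrm{vol}_H$. A patch is an open path-connected subset of the surface. A surface is singly $A$-fittable ($A>0$) if no two distinct patches of area larger than $A$ are isometric for the Riemannian metric of the surface. **Theorem.** Let $R>0$ and $\rho>0$. 1. If $\mathcal M=(\mathbb D,\mu)$ and $\mathcal N=(\mathbb D,\nu)$ are disk-type surfaces with $\mathbf d^R(\mathcal M,\mathcal N)=0$, then there exist $m\in M_D$ and $A>0$ such that, if $\mathcal M$ and $\mathcal N$ are both singly $A$-fittable, then $\mu(m(z))=\nu(z)$ for all $z\in\Omega_{0,\rho}$, and $m$ is a Riemannian isometry from the interior of $\Omega_{0,\rho}$, as a part of $\mathcal N$, onto its image in $\mathcal M$. 2. The threshold can be chosen uniformly: for every $c>0$ there is $A>0$, depending only on $R$, $\rho$ and $c$, such that for all disk-type surfaces $\mathcal M=(\mathbb D,\mu)$ and $\mathcal N=(\mathbb D,\nu)$ with $\mathbf d^R(\mathcal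 M,\mathcal N)=0$ and $\nu\ge c$ on $\Omega_{0,\rho}$ there is $m\in M_D$ such that the conclusion of part 1 holds with this $m$ and this $A$. -/

import Mathlib

noncomputable section

/-- The disk-preserving Möbius transformation `z ↦ e^{iθ} (z - a) / (1 - conj a * z)`. -/
def diskMobius (a : ℂ) (θ : ℝ) (z : ℂ) : ℂ :=
  Complex.exp (θ * Complex.I) * ((z - a) / (1 - (starRingEnd ℂ) a * z))

/-- The family of all disk-preserving Möbius transformations of the open unit disk. -/
def diskMobiusGroup : Set (ℂ → ℂ) :=
  {m | ∃ (a : ℂ) (θ : ℝ), ‖a‖ < 1 ∧ m = diskMobius a θ}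

/-- The (closed) hyperbolic geodesic disk of radius `R` centered at the point `z₀` of the open unit
disk, for the hyperbolic metric `(1 - |z|²)⁻² (dx² + dy²)`: the preimage of `{|z| ≤ tanh R}` under
a disk-preserving Möbius transformation that maps `z₀` to `0`. -/
def hypDisk (z₀ : ℂ) (R : ℝ) : Set ℂ :=
  {z | ‖z‖ < 1 ∧ ‖diskMobius z₀ 0 z‖ ≤ Real.tanh R}

/-- The hyperbolic area `(1 - |z|²)⁻² dx dy` of the open unit disk, as a measure on `ℂ` that does
not charge the complement of the disk. -/
def hypVol : MeasureTheory.Measure ℂ :=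
  (MeasureTheory.volume.restrict (Metric.ball (0 : ℂ) 1)).withDensity
    (fun z => ENNReal.ofReal (((1 - ‖z‖ ^ 2) ^ 2)⁻¹))

/-- A disk-type surface of area `1` in its conformal representation `(𝔻, μ)`: the open unit disk
with the Riemannian metric `μ(z) (1 - |z|²)⁻² (dx² + dy²)`, where `μ` is the (hyperbolic) conformal
factor. The values of `μ` outside the open unit disk are irrelevant. -/
structure DiskSurface where
  /-- the conformal factor with respect to the hyperbolic metric -/
  μ : ℂ → ℝ
  continuousOn : ContinuousOn μ (Metric.ball (0 : ℂ) 1)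
  pos : ∀ z ∈ Metric.ball (0 : ℂ) 1, 0 < μ z
  total_area : ∫⁻ z, ENNReal.ofReal (μ z) ∂hypVol = 1

namespace DiskSurface

/-- The area measure of the surface, `μ` times the hyperbolic area. -/
def area (M : DiskSurface) : MeasureTheory.Measure ℂ :=
  hypVol.withDensity (fun z => ENNReal.ofReal (M.μ z))

/-- The Riemannian metric of the surface at the point `z`, applied to the tangent vectors `v`, `w`. -/
def metric (M : DiskSurface) (z v w : ℂ) : ℝ :=
  M.μ z * ((1 - ‖z‖ ^ 2) ^ 2)⁻¹ * inner ℝ v w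

/-- `f` is a Riemannian isometry of the open set `U` of the surface `M` onto the set `V` of the
surface `N`: a `C¹` bijection of `U` onto `V` that pulls the metric of `N` back to that of `M`.
(Such a map has an invertible derivative, hence a `C¹` inverse; it is holomorphic or antiholomorphic
on each component of `U`, hence smooth.) -/
def IsIsometryOn (M N : DiskSurface) (f : ℂ → ℂ) (U V : Set ℂ) : Prop :=
  ContDiffOn ℝ 1 f U ∧ Set.BijOn f U V ∧
    ∀ z ∈ U, ∀ v w : ℂ, N.metric (f z) (fderiv ℝ f z v) (fderiv ℝ f z w) = M.metric z v w

/-- A patch: an open path-connected set of points of the surface. -/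
def IsPatch (U : Set ℂ) : Prop :=
  U ⊆ Metric.ball (0 : ℂ) 1 ∧ IsOpen U ∧ IsPathConnected U

/-- The surface is singly `A`-fittable: no two different patches of area larger than `A` are
isometric. (Equivalently, the identity is the only isometry between patches of area larger than
`A`: given an isometry `f` of such a patch onto itself and a point `p ≠ f p`, removing a small closed
disk around `p` leads to two different isometric patches.) -/
def SinglyFittable (M : DiskSurface) (A : ℝ) : Prop :=
  ¬ ∃ (U V : Set ℂ) (f : ℂ → ℂ), IsPatch U ∧ IsPatch V ∧
    ENNReal.ofReal A < M.area U ∧ ENNReal.ofReal A < M.area V ∧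
    U ≠ V ∧ M.IsIsometryOn M f U V

/-- The local dissimilarity `d^R_{μ,ν}(z₀, w₀)` of the neighborhoods of radius `R` of `z₀` and `w₀`:
the infimum, over the disk-preserving Möbius transformations `m` with `m z₀ = w₀`, of the integral
of `|μ(z) - ν(m(z))|` over the hyperbolic disk of radius `R` around `z₀` with respect to the
hyperbolic area. -/
def localCost (R : ℝ) (M N : DiskSurface) (z₀ w₀ : ℂ) : ENNReal :=
  ⨅ m ∈ diskMobiusGroup, ⨅ _ : m z₀ = w₀,
    ∫⁻ z in hypDisk z₀ R, ENNReal.ofReal |M.μ z - N.μ (m z)| ∂hypVol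

/-- The transportation plans between the area measures of the two surfaces. (The marginals force
such a plan to be a probability measure concentrated on the product of the open unit disks.) -/
def transportPlans (M N : DiskSurface) : Set (MeasureTheory.Measure (ℂ × ℂ)) :=
  {π | π.map Prod.fst = M.area ∧ π.map Prod.snd = N.area}

/-- The conformal Wasserstein distance `𝐝^R(M, N)`: the optimal transportation cost between the two
area measures for the cost function `d^R_{μ,ν}`. -/
def confWassersteinDist (R : ℝ) (M N : DiskSurface) : ENNReal :=
  ⨅ π ∈ transportPlans M N, ∫⁻ p, localCost R M N p.1 p.2 ∂π

end DiskSurface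

end

open Set Metric Filter Topology MeasureTheory ComplexConjugate

/-! Distance zero yields exact local matchings by compactness. Given a small disk in the second
surface, choose a compact `K` so large in the first that every transport plan charges `K` times that
disk with a mass bounded below. Hence pairs of arbitrarily small local cost lie there, with nearly
optimal Möbius maps. Since base points and their images stay in compact parts of the disk, these
maps cannot degenerate. A limit map matches the conformal factors exactly on an open hyperbolic disk
of radius `R` (`exists_matching`), which contains a Euclidean ball of controlled size
(`exists_matching_ball`).

Single fittability makes the matchings unique. If `m₁` and `m₂` both match a large patch `U`, then
`m₁ '' U` and `m₂ '' U` are isometric patches, hence equal. Comparing a ball with the same ball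
punctured at `p` forces `m₁ p = m₂ p`, and the identity theorem gives equality on the whole disk
(`SinglyFittable.eqOn`). Matchings at nearby points share a ball of definite area, so they agree;
connectedness of the closed disk leaves a single map. -/

/-! ### Möbius transformations of the disk -/

lemma one_sub_conj_mul_ne_zero {a z : ℂ} (ha : ‖a‖ ≤ 1) (hz : ‖z‖ < 1) : 1 - conj a * z ≠ 0 := by
  intro h
  have h1 : ‖conj a * z‖ = 1 := by rw [← sub_eq_zero.1 h, norm_one]
  rw [norm_mul, Complex.norm_conj] at h1
  nlinarith [norm_nonneg a, norm_nonneg z]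

lemma one_sub_norm_sq_pos {z : ℂ} (hz : ‖z‖ < 1) : 0 < 1 - ‖z‖ ^ 2 := by
  nlinarith [norm_nonneg z]

lemma ofReal_norm_sq (z : ℂ) : ((‖z‖ : ℂ)) ^ 2 = conj z * z := (Complex.conj_mul' z).symm

/-- The identity `|1 - ā z|² - |z - a|² = (1 - |a|²) (1 - |z|²)`. -/
lemma norm_one_sub_conj_mul_sq_sub (a z : ℂ) :
    ‖1 - conj a * z‖ ^ 2 - ‖z - a‖ ^ 2 = (1 - ‖a‖ ^ 2) * (1 - ‖z‖ ^ 2) := by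
  have h : (((‖1 - conj a * z‖ ^ 2 - ‖z - a‖ ^ 2 : ℝ)) : ℂ) =
      (((1 - ‖a‖ ^ 2) * (1 - ‖z‖ ^ 2) : ℝ) : ℂ) := by
    push_cast
    simp only [ofReal_norm_sq, map_sub, map_mul, map_one, Complex.conj_conj]
    ring
  exact_mod_cast h

lemma norm_diskMobius (a : ℂ) (θ : ℝ) (z : ℂ) :
    ‖diskMobius a θ z‖ = ‖z - a‖ / ‖1 - conj a * z‖ := by
  simp [diskMobius]

lemma one_sub_norm_diskMobius_sq {a : ℂ} (ha : ‖a‖ ≤ 1) (θ : ℝ) {z : ℂ} (hz : ‖z‖ < 1) :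
    1 - ‖diskMobius a θ z‖ ^ 2 = (1 - ‖a‖ ^ 2) * (1 - ‖z‖ ^ 2) / ‖1 - conj a * z‖ ^ 2 := by
  have h := norm_pos_iff.2 (one_sub_conj_mul_ne_zero ha hz)
  rw [norm_diskMobius, ← norm_one_sub_conj_mul_sq_sub, div_pow, sub_div, div_self (by positivity)]

lemma norm_diskMobius_lt_one {a : ℂ} (ha : ‖a‖ < 1) (θ : ℝ) {z : ℂ} (hz : ‖z‖ < 1) :
    ‖diskMobius a θ z‖ < 1 := by
  have h := norm_pos_iff.2 (one_sub_conj_mul_ne_zero ha.le hz)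
  have h2 := one_sub_norm_diskMobius_sq ha.le θ hz
  have h3 : 0 < 1 - ‖diskMobius a θ z‖ ^ 2 := by
    rw [h2]
    have := one_sub_norm_sq_pos ha
    have := one_sub_norm_sq_pos hz
    positivity
  nlinarith [norm_nonneg (diskMobius a θ z)]

lemma hasDerivAt_diskMobius {a : ℂ} (ha : ‖a‖ < 1) (θ : ℝ) {z : ℂ} (hz : ‖z‖ < 1) :
    HasDerivAt (diskMobius a θ)
      (Complex.exp (θ * Complex.I) * ((1 - conj a * a) / (1 - conj a * z) ^ 2)) z := by
  have h := one_sub_conj_mul_ne_zero ha.le hz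
  have h1 : HasDerivAt (fun z => z - a) 1 z := (hasDerivAt_id z).sub_const a
  have h2 : HasDerivAt (fun z => 1 - conj a * z) (-(conj a * 1)) z :=
    ((hasDerivAt_id z).const_mul (conj a)).const_sub 1
  refine ((h1.div h2 h).const_mul (Complex.exp (θ * Complex.I))).congr_deriv ?_
  field_simp
  ring

/-! ### Hyperbolic isometries and the transport of metric and area -/

/-- A holomorphic self-map of the unit disk that preserves the hyperbolic metric. -/
structure IsHyperbolicIsometry (f : ℂ → ℂ) : Prop where
  differentiableOn : DifferentiableOn ℂ f (ball 0 1)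
  mapsTo : MapsTo f (ball 0 1) (ball 0 1)
  norm_deriv : ∀ z ∈ ball (0 : ℂ) 1, ‖deriv f z‖ * (1 - ‖z‖ ^ 2) = 1 - ‖f z‖ ^ 2

lemma isHyperbolicIsometry_of_mem {m : ℂ → ℂ} (hm : m ∈ diskMobiusGroup) :
    IsHyperbolicIsometry m := by
  obtain ⟨a, θ, ha, rfl⟩ := hm
  refine ⟨fun z hz => ?_, fun z hz => ?_, fun z hz => ?_⟩
  · exact (hasDerivAt_diskMobius ha θ (mem_ball_zero_iff.1 hz)).differentiableAt.differentiableWithinAt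
  · exact mem_ball_zero_iff.2 (norm_diskMobius_lt_one ha θ (mem_ball_zero_iff.1 hz))
  · rw [mem_ball_zero_iff] at hz
    rw [(hasDerivAt_diskMobius ha θ hz).deriv, one_sub_norm_diskMobius_sq ha.le θ hz, norm_mul,
      Complex.norm_exp_ofReal_mul_I, norm_div, norm_pow]
    have h : 1 - conj a * a = ((1 - ‖a‖ ^ 2 : ℝ) : ℂ) := by
      push_cast
      rw [ofReal_norm_sq]
    rw [h, Complex.norm_real, Real.norm_of_nonneg (one_sub_norm_sq_pos ha).le]
    ring

namespace IsHyperbolicIsometry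

variable {f g : ℂ → ℂ}

lemma differentiableAt (hf : IsHyperbolicIsometry f) {z : ℂ} (hz : z ∈ ball (0 : ℂ) 1) :
    DifferentiableAt ℂ f z :=
  (hf.differentiableOn z hz).differentiableAt (isOpen_ball.mem_nhds hz)

lemma comp (hg : IsHyperbolicIsometry g) (hf : IsHyperbolicIsometry f) :
    IsHyperbolicIsometry (g ∘ f) := by
  refine ⟨hg.differentiableOn.comp hf.differentiableOn hf.mapsTo, hg.mapsTo.comp hf.mapsTo,
    fun z hz => ?_⟩
  rw [deriv_comp z (hg.differentiableAt (hf.mapsTo hz)) (hf.differentiableAt hz), norm_mul,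
    mul_assoc, hf.norm_deriv z hz, hg.norm_deriv _ (hf.mapsTo hz), Function.comp_apply]

lemma norm_deriv_sq_mul (hf : IsHyperbolicIsometry f) {z : ℂ} (hz : z ∈ ball (0 : ℂ) 1) :
    ‖deriv f z‖ ^ 2 * ((1 - ‖f z‖ ^ 2) ^ 2)⁻¹ = ((1 - ‖z‖ ^ 2) ^ 2)⁻¹ := by
  have h1 := one_sub_norm_sq_pos (mem_ball_zero_iff.1 hz)
  have h2 := one_sub_norm_sq_pos (mem_ball_zero_iff.1 (hf.mapsTo hz))
  have h3 : ‖deriv f z‖ ≠ 0 := by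
    intro h
    have := hf.norm_deriv z hz
    rw [h, zero_mul] at this
    exact h2.ne this
  rw [← hf.norm_deriv z hz]
  field_simp

lemma contDiffOn (hf : IsHyperbolicIsometry f) : ContDiffOn ℝ 1 f (ball 0 1) :=
  (hf.differentiableOn.contDiffOn isOpen_ball : ContDiffOn ℂ 1 f _).restrict_scalars ℝ

lemma hasFDerivAt (hf : IsHyperbolicIsometry f) {z : ℂ} (hz : z ∈ ball (0 : ℂ) 1) :
    HasFDerivAt f ((ContinuousLinearMap.toSpanSingleton ℂ (deriv f z)).restrictScalars ℝ) z :=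
  (hf.differentiableAt hz).hasDerivAt.hasFDerivAt.restrictScalars ℝ

end IsHyperbolicIsometry

lemma inner_mul_mul (v w d : ℂ) : inner ℝ (v * d) (w * d) = ‖d‖ ^ 2 * inner ℝ v w := by
  have h : ‖d‖ ^ 2 = d.re ^ 2 + d.im ^ 2 := by
    rw [← Complex.normSq_eq_norm_sq, Complex.normSq_apply]; ring
  simp only [Complex.inner, h, Complex.mul_re, Complex.mul_im, Complex.conj_re, Complex.conj_im,
    map_mul]
  ring

/-- The real determinant of multiplication by `d` is the field norm of `d` over `ℝ`. -/
lemma abs_det_toSpanSingleton (d : ℂ) :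
    |((ContinuousLinearMap.toSpanSingleton ℂ d).restrictScalars ℝ : ℂ →L[ℝ] ℂ).det| = ‖d‖ ^ 2 := by
  have h : ((ContinuousLinearMap.toSpanSingleton ℂ d).restrictScalars ℝ : ℂ →L[ℝ] ℂ).det
      = Algebra.norm ℝ d := by
    rw [Algebra.norm_apply, ContinuousLinearMap.det]
    congr 1
    ext; simp [mul_comm]
  rw [h, Algebra.norm_complex_apply, Complex.normSq_eq_norm_sq, abs_of_nonneg (sq_nonneg _)]

/-- A hyperbolic isometry that transports the conformal factors transports the metrics. -/
lemma DiskSurface.isIsometryOn_image {M N : DiskSurface} {f : ℂ → ℂ}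
    (hf : IsHyperbolicIsometry f) {U : Set ℂ} (hU : U ⊆ ball 0 1) (hinj : InjOn f U)
    (hμ : ∀ z ∈ U, N.μ (f z) = M.μ z) : M.IsIsometryOn N f U (f '' U) := by
  refine ⟨hf.contDiffOn.mono hU, hinj.bijOn_image, fun z hz v w => ?_⟩
  rw [(hf.hasFDerivAt (hU hz)).fderiv]
  simp only [DiskSurface.metric, ContinuousLinearMap.coe_restrictScalars',
    ContinuousLinearMap.toSpanSingleton_apply, smul_eq_mul]
  rw [inner_mul_mul, hμ z hz, ← hf.norm_deriv_sq_mul (hU hz)]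
  ring

lemma DiskSurface.area_apply (M : DiskSurface) {U : Set ℂ} (hU : MeasurableSet U)
    (hUb : U ⊆ ball 0 1) :
    M.area U = ∫⁻ z in U, ENNReal.ofReal (((1 - ‖z‖ ^ 2) ^ 2)⁻¹) * ENNReal.ofReal (M.μ z) := by
  -- `M.μ` may fail to be measurable off the disk; finiteness of the hyperbolic density is what
  -- allows the densities to be multiplied.
  rw [DiskSurface.area, withDensity_apply _ hU, hypVol,
    setLIntegral_withDensity_eq_setLIntegral_mul_non_measurable₀ _ (by fun_prop) _ hU (by simp),
    Measure.restrict_restrict hU, inter_eq_left.2 hUb]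
  rfl

/-- In the change of variables the Jacobian `‖f'‖²` turns the hyperbolic density at `f z` into the
one at `z`. -/
lemma DiskSurface.area_image {M N : DiskSurface} {f : ℂ → ℂ}
    (hf : IsHyperbolicIsometry f) {U : Set ℂ} (hUm : MeasurableSet U) (hU : U ⊆ ball 0 1)
    (hinj : InjOn f U) (hμ : ∀ z ∈ U, N.μ (f z) = M.μ z) : N.area (f '' U) = M.area U := by
  have hd : ∀ z ∈ U, HasFDerivWithinAt f
      ((ContinuousLinearMap.toSpanSingleton ℂ (deriv f z)).restrictScalars ℝ) U z :=
    fun z hz => (hf.hasFDerivAt (hU hz)).hasFDerivWithinAt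
  rw [N.area_apply (measurable_image_of_fderivWithin hUm hd hinj)
    ((image_mono hU).trans hf.mapsTo.image_subset), M.area_apply hUm hU,
    lintegral_image_eq_lintegral_abs_det_fderiv_mul volume hUm hd hinj]
  refine setLIntegral_congr_fun hUm fun z hz => ?_
  rw [hμ z hz, abs_det_toSpanSingleton, ← mul_assoc, ← ENNReal.ofReal_mul (by positivity),
    hf.norm_deriv_sq_mul (hU hz)]

/-! ### Inverses and invariance of the pseudo-hyperbolic distance -/

lemma diskMobius_neg_diskMobius {a : ℂ} (ha : ‖a‖ < 1) (θ : ℝ) {z : ℂ} (hz : ‖z‖ < 1) :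
    diskMobius (-(Complex.exp (θ * Complex.I) * a)) (-θ) (diskMobius a θ z) = z := by
  have h1 := one_sub_conj_mul_ne_zero ha.le hz
  have h2 := one_sub_conj_mul_ne_zero ha.le ha
  have hc : conj (Complex.exp (θ * Complex.I)) = (Complex.exp (θ * Complex.I))⁻¹ := by
    rw [← Complex.exp_conj, ← Complex.exp_neg]; simp
  have he := Complex.exp_ne_zero (θ * Complex.I)
  have hn : Complex.exp ((-θ : ℝ) * Complex.I) = (Complex.exp (θ * Complex.I))⁻¹ := by
    rw [← Complex.exp_neg]; simp
  simp only [diskMobius, hn, map_neg, map_mul, hc]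
  set e := Complex.exp (θ * Complex.I)
  have h3 : 1 - -(e⁻¹ * conj a) * (e * ((z - a) / (1 - conj a * z))) =
      (1 - conj a * a) / (1 - conj a * z) := by
    generalize hD : 1 - conj a * z = D at *
    field_simp
    rw [← hD]
    ring
  have h4 : e * ((z - a) / (1 - conj a * z)) - -(e * a) =
      e * (z * (1 - conj a * a) / (1 - conj a * z)) := by
    generalize hD : 1 - conj a * z = D at *
    field_simp
    rw [← hD]
    ring
  rw [h3, h4]
  generalize 1 - conj a * z = D at *
  generalize 1 - conj a * a = F at *
  field_simp

lemma exists_inverse_of_mem {m : ℂ → ℂ} (hm : m ∈ diskMobiusGroup) :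
    ∃ m' ∈ diskMobiusGroup, LeftInvOn m' m (ball 0 1) ∧ RightInvOn m' m (ball 0 1) := by
  obtain ⟨a, θ, ha, rfl⟩ := hm
  have ha' : ‖-(Complex.exp (θ * Complex.I) * a)‖ < 1 := by
    rwa [norm_neg, norm_mul, Complex.norm_exp_ofReal_mul_I, one_mul]
  refine ⟨_, ⟨_, -θ, ha', rfl⟩, fun z hz => ?_, fun z hz => ?_⟩
  · exact diskMobius_neg_diskMobius ha θ (mem_ball_zero_iff.1 hz)
  -- The parameter change is an involution, so the left inverse formula for the inverse map is the
  -- right inverse formula.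
  · have h := diskMobius_neg_diskMobius ha' (-θ) (mem_ball_zero_iff.1 hz)
    have h2 : -(Complex.exp ((-θ : ℝ) * Complex.I) * -(Complex.exp (θ * Complex.I) * a)) = a := by
      have : Complex.exp ((-θ : ℝ) * Complex.I) = (Complex.exp (θ * Complex.I))⁻¹ := by
        rw [← Complex.exp_neg]; simp
      rw [this]
      field_simp [Complex.exp_ne_zero]
    rwa [h2, neg_neg] at h

lemma injOn_of_mem {m : ℂ → ℂ} (hm : m ∈ diskMobiusGroup) : InjOn m (ball 0 1) :=
  let ⟨_, _, h, _⟩ := exists_inverse_of_mem hm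
  h.injOn

/-- Disk-preserving Möbius transformations preserve the pseudo-hyperbolic distance. -/
lemma norm_diskMobius_apply_apply {m : ℂ → ℂ} (hm : m ∈ diskMobiusGroup) {x y : ℂ}
    (hx : ‖x‖ < 1) (hy : ‖y‖ < 1) : ‖diskMobius (m x) 0 (m y)‖ = ‖diskMobius x 0 y‖ := by
  obtain ⟨a, θ, ha, rfl⟩ := hm
  have h1 := one_sub_conj_mul_ne_zero ha.le hx
  have h2 := one_sub_conj_mul_ne_zero ha.le hy
  have h1' : 1 - a * conj x ≠ 0 := by
    have := (map_ne_zero (starRingEnd ℂ)).2 h1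
    simpa using this
  have h3 := one_sub_conj_mul_ne_zero ha.le ha
  have h4 := one_sub_conj_mul_ne_zero hx.le hy
  have hc : conj (Complex.exp (θ * Complex.I)) = (Complex.exp (θ * Complex.I))⁻¹ := by
    rw [← Complex.exp_conj, ← Complex.exp_neg]; simp
  have he := Complex.exp_ne_zero (θ * Complex.I)
  -- Numerator and denominator acquire the same extra factors up to modulus, so they cancel in the
  -- quotient of norms.
  have e1 : diskMobius a θ y - diskMobius a θ x = Complex.exp (θ * Complex.I) *
      ((y - x) * (1 - conj a * a) / ((1 - conj a * x) * (1 - conj a * y))) := by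
    rw [diskMobius, diskMobius, ← mul_sub, div_sub_div _ _ h2 h1,
      mul_comm (1 - conj a * x) (1 - conj a * y)]
    ring
  have e2 : 1 - conj (diskMobius a θ x) * diskMobius a θ y =
      (1 - conj a * a) * (1 - conj x * y) / ((1 - a * conj x) * (1 - conj a * y)) := by
    simp only [diskMobius, map_mul, map_div₀, map_sub, map_one, Complex.conj_conj, hc]
    rw [mul_mul_mul_comm, inv_mul_cancel₀ he, one_mul, div_mul_div_comm,
      eq_div_iff (mul_ne_zero h1' h2), sub_mul, div_mul_cancel₀ _ (mul_ne_zero h1' h2)]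
    ring
  have e3 : ‖1 - a * conj x‖ = ‖1 - conj a * x‖ := by
    rw [← Complex.norm_conj]; simp
  rw [norm_diskMobius, norm_diskMobius, e1, e2]
  simp only [norm_mul, norm_div, Complex.norm_exp_ofReal_mul_I, e3, one_mul]
  rw [div_div_div_eq, mul_comm, ← mul_assoc, mul_comm ‖1 - conj a * a‖ ‖1 - conj x * y‖]
  have n1 := norm_ne_zero_iff.2 h1
  have n2 := norm_ne_zero_iff.2 h2
  have n3 := norm_ne_zero_iff.2 h3
  generalize ‖1 - conj a * x‖ = p at *
  generalize ‖1 - conj a * y‖ = q at *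
  generalize ‖1 - conj a * a‖ = r at *
  generalize ‖1 - conj x * y‖ = s at *
  field_simp

/-! ### Area estimates -/

lemma volume_le_hypVol {U : Set ℂ} (hU : MeasurableSet U) (hUb : U ⊆ ball 0 1) :
    volume U ≤ hypVol U := by
  rw [hypVol, withDensity_apply _ hU, Measure.restrict_restrict hU, inter_eq_left.2 hUb,
    ← setLIntegral_one]
  refine setLIntegral_mono' hU fun z hz => ENNReal.one_le_ofReal.2 ?_
  have h := one_sub_norm_sq_pos (mem_ball_zero_iff.1 (hUb hz))
  refine (one_le_inv₀ (by positivity)).2 ?_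
  nlinarith [sq_nonneg ‖z‖]

lemma DiskSurface.ofReal_mul_volume_le_area (M : DiskSurface) {U : Set ℂ} (hU : MeasurableSet U)
    (hUb : U ⊆ ball 0 1) {c : ℝ} (hc : ∀ z ∈ U, c ≤ M.μ z) :
    ENNReal.ofReal c * volume U ≤ M.area U := by
  rw [DiskSurface.area, withDensity_apply _ hU]
  calc ENNReal.ofReal c * volume U ≤ ENNReal.ofReal c * hypVol U := by
        exact mul_le_mul' le_rfl (volume_le_hypVol hU hUb)
    _ = ∫⁻ _ in U, ENNReal.ofReal c ∂hypVol := (setLIntegral_const _ _).symm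
    _ ≤ _ := setLIntegral_mono' hU fun z hz => ENNReal.ofReal_le_ofReal (hc z hz)

lemma DiskSurface.exists_pos_le (M : DiskSurface) {K : Set ℂ} (hK : IsCompact K)
    (hKb : K ⊆ ball 0 1) : ∃ c : ℝ, 0 < c ∧ ∀ z ∈ K, c ≤ M.μ z := by
  rcases K.eq_empty_or_nonempty with rfl | hne
  · exact ⟨1, one_pos, by simp⟩
  · obtain ⟨x, hx, hmin⟩ := hK.exists_isMinOn hne (M.continuousOn.mono hKb)
    exact ⟨M.μ x, M.pos x (hKb hx), fun z hz => hmin hz⟩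

lemma DiskSurface.area_univ (M : DiskSurface) : M.area univ = 1 := by
  rw [DiskSurface.area, withDensity_apply _ MeasurableSet.univ, Measure.restrict_univ,
    M.total_area]

instance (M : DiskSurface) : IsProbabilityMeasure M.area := ⟨M.area_univ⟩

lemma DiskSurface.area_ball (M : DiskSurface) : M.area (ball 0 1) = 1 := by
  rw [DiskSurface.area, withDensity_apply _ measurableSet_ball, hypVol,
    restrict_withDensity measurableSet_ball, Measure.restrict_restrict measurableSet_ball,
    inter_self, ← hypVol, M.total_area]

/-! ### Compactness: from distance zero to exact local matching -/

lemma continuousAt_diskMobius {a : ℂ} {θ : ℝ} {z : ℂ} (h : 1 - conj a * z ≠ 0) :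
    ContinuousAt (fun p : ℂ × ℝ × ℂ => diskMobius p.1 p.2.1 p.2.2) (a, θ, z) := by
  unfold diskMobius
  refine ContinuousAt.mul (by fun_prop) (ContinuousAt.div (by fun_prop) ?_ h)
  exact (continuous_const.sub ((Complex.continuous_conj.comp continuous_fst).mul
    continuous_snd.snd)).continuousAt

/-- At distance zero, pairs of points of arbitrarily small local cost can be found with the second
point in a given disk and the first point in a compact set that depends only on that disk. -/
lemma DiskSurface.exists_isCompact_localCost_lt {R : ℝ} {M N : DiskSurface}
    (h : confWassersteinDist R M N = 0) {w : ℂ} {r : ℝ} (hr : 0 < r)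
    (hw : closedBall w r ⊆ ball 0 1) :
    ∃ K : Set ℂ, IsCompact K ∧ K ⊆ ball 0 1 ∧ ∀ δ : ENNReal, 0 < δ →
      ∃ z ∈ K, ∃ w' ∈ closedBall w r, localCost R M N z w' < δ := by
  have ha : 0 < N.area (closedBall w r) := by
    obtain ⟨c, hc, hcN⟩ := N.exists_pos_le (isCompact_closedBall w r) hw
    refine lt_of_lt_of_le ?_ (N.ofReal_mul_volume_le_area measurableSet_closedBall hw hcN)
    exact ENNReal.mul_pos (by simpa using hc) (measure_closedBall_pos _ _ hr).ne'
  obtain ⟨K, hKb, hK, hlt⟩ := isOpen_ball.exists_lt_isCompact (μ := M.area) (U := ball (0 : ℂ) 1)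
    (r := 1 - N.area (closedBall w r))
    (by rw [M.area_ball]; exact ENNReal.sub_lt_self ENNReal.one_ne_top one_ne_zero ha.ne')
  refine ⟨K, hK, hKb, fun δ hδ => ?_⟩
  by_contra! hcon
  -- Two events of a probability measure meet in mass at least the sum of their masses minus one;
  -- `b` is this bound for every plan.
  set b := M.area K + N.area (closedBall w r) - 1 with hb
  have hb0 : 0 < b :=
    tsub_pos_of_lt ((ENNReal.sub_lt_iff_lt_right (measure_ne_top _ _) prob_le_one).1 hlt)
  have key : δ * b ≤ confWassersteinDist R M N := by
    refine le_iInf₂ fun π hπ => ?_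
    obtain ⟨h1, h2⟩ := hπ
    have hu : π univ = 1 := by
      rw [← M.area_univ, ← h1, Measure.map_apply measurable_fst MeasurableSet.univ, preimage_univ]
    have hm : MeasurableSet (K ×ˢ closedBall w r) :=
      hK.measurableSet.prod measurableSet_closedBall
    have hbπ : b ≤ π (K ×ˢ closedBall w r) := by
      rw [hb, tsub_le_iff_left, ← h1, ← h2,
        Measure.map_apply measurable_fst hK.measurableSet,
        Measure.map_apply measurable_snd measurableSet_closedBall,
        ← measure_union_add_inter _ (measurable_snd measurableSet_closedBall), ← hu]
      exact add_le_add (measure_mono (subset_univ _)) le_rfl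
    calc δ * b ≤ δ * π (K ×ˢ closedBall w r) := by gcongr
      _ = ∫⁻ _ in K ×ˢ closedBall w r, δ ∂π := (setLIntegral_const _ _).symm
      _ ≤ ∫⁻ p in K ×ˢ closedBall w r, localCost R M N p.1 p.2 ∂π :=
        setLIntegral_mono' hm fun p hp => hcon p.1 hp.1 p.2 hp.2
      _ ≤ _ := setLIntegral_le_lintegral _ _
  rw [h] at key
  exact (ENNReal.mul_pos hδ.ne' hb0.ne').not_ge key

/-- Reducing the angle to its principal value confines it to a compact interval, as needed to
extract convergent parameters. -/
lemma DiskSurface.exists_diskMobius_of_localCost_lt {R : ℝ} {M N : DiskSurface} {z w : ℂ}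
    {δ : ENNReal} (h : localCost R M N z w < δ) :
    ∃ (a : ℂ) (θ : ℝ), ‖a‖ < 1 ∧ θ ∈ Icc (-Real.pi) Real.pi ∧ diskMobius a θ z = w ∧
      ∫⁻ x in hypDisk z R, ENNReal.ofReal |M.μ x - N.μ (diskMobius a θ x)| ∂hypVol < δ := by
  simp only [localCost, iInf_lt_iff] at h
  obtain ⟨m, ⟨a, θ, ha, rfl⟩, hz, hlt⟩ := h
  have he : Complex.exp ((Complex.exp (θ * Complex.I)).arg * Complex.I) =
      Complex.exp (θ * Complex.I) := by
    have := Complex.norm_mul_exp_arg_mul_I (Complex.exp (θ * Complex.I))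
    rwa [Complex.norm_exp_ofReal_mul_I, Complex.ofReal_one, one_mul] at this
  have hm : diskMobius a (Complex.exp (θ * Complex.I)).arg = diskMobius a θ := by
    funext x
    rw [diskMobius, he, diskMobius]
  refine ⟨a, (Complex.exp (θ * Complex.I)).arg, ha,
    ⟨(Complex.neg_pi_lt_arg _).le, Complex.arg_le_pi _⟩, ?_⟩
  rw [hm]
  exact ⟨hz, hlt⟩

/-- A limit of Möbius transformations along which the local costs tend to zero matches the
conformal factors exactly. -/
lemma DiskSurface.eq_of_tendsto_lintegral {R : ℝ} {M N : DiskSurface} {u : ℕ → ℂ × ℂ × ℝ}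
    {z a : ℂ} {θ : ℝ} (ha : ‖a‖ < 1) (hz : ‖z‖ < 1) (hu : Tendsto u atTop (𝓝 (z, a, θ)))
    (hint : Tendsto (fun n => ∫⁻ x in hypDisk (u n).1 R,
      ENNReal.ofReal |M.μ x - N.μ (diskMobius (u n).2.1 (u n).2.2 x)| ∂hypVol) atTop (𝓝 0))
    {x : ℂ} (hx : ‖x‖ < 1) (hxR : ‖diskMobius z 0 x‖ < Real.tanh R) :
    M.μ x = N.μ (diskMobius a θ x) := by
  by_contra hne
  obtain ⟨δ, hδ, hδlt⟩ := exists_between (abs_pos.2 (sub_ne_zero.2 hne))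
  have c1 : ContinuousAt (fun q : (ℂ × ℂ × ℝ) × ℂ => diskMobius q.1.2.1 q.1.2.2 q.2)
      ((z, a, θ), x) :=
    ContinuousAt.comp (f := fun q : (ℂ × ℂ × ℝ) × ℂ => (q.1.2.1, q.1.2.2, q.2))
      (continuousAt_diskMobius (one_sub_conj_mul_ne_zero ha.le hx)) (by fun_prop)
  have c2 : ContinuousAt (fun q : (ℂ × ℂ × ℝ) × ℂ => ‖diskMobius q.1.1 0 q.2‖)
      ((z, a, θ), x) :=
    (ContinuousAt.comp (f := fun q : (ℂ × ℂ × ℝ) × ℂ => (q.1.1, (0 : ℝ), q.2))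
      (continuousAt_diskMobius (one_sub_conj_mul_ne_zero hz.le hx)) (by fun_prop)).norm
  have cM : ContinuousAt M.μ x :=
    M.continuousOn.continuousAt (isOpen_ball.mem_nhds (mem_ball_zero_iff.2 hx))
  have cN : ContinuousAt N.μ (diskMobius a θ x) := N.continuousOn.continuousAt
    (isOpen_ball.mem_nhds (mem_ball_zero_iff.2 (norm_diskMobius_lt_one ha θ hx)))
  have c3 : ContinuousAt (fun q : (ℂ × ℂ × ℝ) × ℂ =>
      |M.μ q.2 - N.μ (diskMobius q.1.2.1 q.1.2.2 q.2)|) ((z, a, θ), x) :=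
    ((ContinuousAt.comp (f := fun q : (ℂ × ℂ × ℝ) × ℂ => q.2) cM (by fun_prop)).sub
      (ContinuousAt.comp (f := fun q : (ℂ × ℂ × ℝ) × ℂ => diskMobius q.1.2.1 q.1.2.2 q.2)
        cN c1)).abs
  have c4 : ContinuousAt (fun q : (ℂ × ℂ × ℝ) × ℂ => ‖q.2‖) ((z, a, θ), x) := by fun_prop
  have hev := (c3.eventually (lt_mem_nhds hδlt)).and
    ((c2.eventually (gt_mem_nhds hxR)).and (c4.eventually (gt_mem_nhds hx)))
  -- Splitting into a product neighborhood gives a ball around `x` that serves all parameters near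
  -- the limit. There the integrand exceeds `δ`, so the integrals cannot tend to zero.
  rw [nhds_prod_eq] at hev
  obtain ⟨pa, hpa, pb, hpb, hp⟩ := eventually_prod_iff.1 hev
  obtain ⟨e, he, hball⟩ := Metric.eventually_nhds_iff_ball.1 hpb
  have hB : ball x e ⊆ ball 0 1 := fun y hy =>
    mem_ball_zero_iff.2 (hp hpa.self_of_nhds (hball y hy)).2.2
  have hpos : 0 < ENNReal.ofReal δ * hypVol (ball x e) :=
    ENNReal.mul_pos (by simpa using hδ)
      ((measure_ball_pos volume x he).trans_le (volume_le_hypVol measurableSet_ball hB)).ne'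
  obtain ⟨n, hn1, hn2⟩ := ((hu.eventually hpa).and (hint.eventually (gt_mem_nhds hpos))).exists
  refine hn2.not_ge ?_
  calc ENNReal.ofReal δ * hypVol (ball x e)
      = ∫⁻ _ in ball x e, ENNReal.ofReal δ ∂hypVol := (setLIntegral_const _ _).symm
    _ ≤ ∫⁻ y in ball x e,
        ENNReal.ofReal |M.μ y - N.μ (diskMobius (u n).2.1 (u n).2.2 y)| ∂hypVol :=
      setLIntegral_mono' measurableSet_ball fun y hy =>
        ENNReal.ofReal_le_ofReal (hp hn1 (hball y hy)).1.le
    _ ≤ _ := lintegral_mono_set <| show ball x e ⊆ hypDisk (u n).1 R from fun y hy =>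
        ⟨(hp hn1 (hball y hy)).2.2, (hp hn1 (hball y hy)).2.1.le⟩

/-- For `‖a‖ = 1` the two norms would be equal and nonzero, which `s < 1` excludes. This keeps
limits of Möbius parameters off the unit circle. -/
lemma norm_lt_one_of_norm_sub_le {a z : ℂ} {s : ℝ} (hs : s < 1) (ha : ‖a‖ ≤ 1) (hz : ‖z‖ < 1)
    (h : ‖z - a‖ ≤ s * ‖1 - conj a * z‖) : ‖a‖ < 1 := by
  refine lt_of_le_of_ne ha fun h1 => ?_
  have h2 := norm_one_sub_conj_mul_sq_sub a z
  rw [h1] at h2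
  have h3 := norm_pos_iff.2 (one_sub_conj_mul_ne_zero ha hz)
  have h4 : ‖z - a‖ < ‖1 - conj a * z‖ := by nlinarith
  nlinarith [norm_nonneg (z - a)]

/-- At distance zero, arbitrarily close to each point of the second surface there is a point whose
neighborhood of radius `R` is matched exactly with a part of the first surface. -/
lemma DiskSurface.exists_matching {R : ℝ} {M N : DiskSurface}
    (h : confWassersteinDist R M N = 0) {w : ℂ} {r : ℝ} (hr : 0 < r)
    (hw : closedBall w r ⊆ ball 0 1) :
    ∃ w' ∈ closedBall w r, ∃ m ∈ diskMobiusGroup, ∀ y : ℂ, ‖y‖ < 1 →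
      ‖diskMobius w' 0 y‖ < Real.tanh R → M.μ (m y) = N.μ y := by
  obtain ⟨K, hK, hKb, hKδ⟩ := exists_isCompact_localCost_lt h hr hw
  obtain ⟨s, hs, hsw⟩ : ∃ s < 1, ∀ y ∈ closedBall w r, ‖y‖ ≤ s := by
    obtain ⟨y, hy, hmax⟩ := (isCompact_closedBall w r).exists_isMaxOn
      ⟨w, mem_closedBall_self hr.le⟩ continuous_norm.continuousOn
    exact ⟨‖y‖, mem_ball_zero_iff.1 (hw hy), fun x hx => hmax hx⟩
  -- For `n = 0` the bound is `⊤`, so no shift of the index is needed.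
  have hseq : ∀ n : ℕ, ∃ p : ℂ × ℂ × ℝ, p.1 ∈ K ∧ ‖p.2.1‖ < 1 ∧
      p.2.2 ∈ Icc (-Real.pi) Real.pi ∧ diskMobius p.2.1 p.2.2 p.1 ∈ closedBall w r ∧
      ∫⁻ x in hypDisk p.1 R, ENNReal.ofReal |M.μ x - N.μ (diskMobius p.2.1 p.2.2 x)| ∂hypVol
        < (n : ENNReal)⁻¹ := fun n => by
    obtain ⟨z, hz, w', hw', hlt⟩ := hKδ (n : ENNReal)⁻¹ (by simp)
    obtain ⟨a, θ, ha, hθ, he, hlt⟩ := exists_diskMobius_of_localCost_lt hlt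
    exact ⟨(z, a, θ), hz, ha, hθ, by rwa [he], hlt⟩
  choose u hu1 hu2 hu3 hu4 hu5 using hseq
  obtain ⟨⟨z, a, θ⟩, ⟨hz, ha, -⟩, φ, hφ, hlim⟩ :=
    (hK.prod ((isCompact_closedBall (0 : ℂ) 1).prod
      (isCompact_Icc (a := -Real.pi) (b := Real.pi)))).tendsto_subseq
      (x := u) fun n => ⟨hu1 n, mem_closedBall_zero_iff.2 (hu2 n).le, hu3 n⟩
  replace hz : ‖z‖ < 1 := mem_ball_zero_iff.1 (hKb hz)
  replace ha : ‖a‖ ≤ 1 := mem_closedBall_zero_iff.1 ha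
  have ha1 : ‖a‖ < 1 := by
    refine norm_lt_one_of_norm_sub_le hs ha hz ?_
    have c1 : Continuous fun p : ℂ × ℂ × ℝ => ‖p.1 - p.2.1‖ := by fun_prop
    have c2 : Continuous fun p : ℂ × ℂ × ℝ => s * ‖1 - conj p.2.1 * p.1‖ :=
      continuous_const.mul (continuous_const.sub
        ((Complex.continuous_conj.comp continuous_snd.fst).mul continuous_fst)).norm
    refine le_of_tendsto_of_tendsto' ((c1.tendsto (z, a, θ)).comp hlim)
      ((c2.tendsto (z, a, θ)).comp hlim)
      fun n => ?_
    have h1 := hsw _ (hu4 (φ n))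
    have h2 := norm_pos_iff.2 (one_sub_conj_mul_ne_zero (hu2 (φ n)).le
      (mem_ball_zero_iff.1 (hKb (hu1 (φ n)))))
    rwa [norm_diskMobius, div_le_iff₀ h2] at h1
  have hm : diskMobius a θ ∈ diskMobiusGroup := ⟨a, θ, ha1, rfl⟩
  obtain ⟨m', hm', -, hr'⟩ := exists_inverse_of_mem hm
  refine ⟨diskMobius a θ z, ?_, m', hm', fun y hy hyR => ?_⟩
  · have c : ContinuousAt (fun p : ℂ × ℂ × ℝ => diskMobius p.2.1 p.2.2 p.1) (z, a, θ) :=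
      ContinuousAt.comp (f := fun p : ℂ × ℂ × ℝ => (p.2.1, p.2.2, p.1))
        (continuousAt_diskMobius (one_sub_conj_mul_ne_zero ha hz)) (by fun_prop)
    exact isClosed_closedBall.mem_of_tendsto (c.tendsto.comp hlim)
      (Eventually.of_forall fun n => hu4 (φ n))
  · have hy' := (isHyperbolicIsometry_of_mem hm').mapsTo (mem_ball_zero_iff.2 hy)
    rw [mem_ball_zero_iff] at hy'
    have hmy := hr' (mem_ball_zero_iff.2 hy)
    have hint : Tendsto (fun n => ∫⁻ x in hypDisk (u (φ n)).1 R, ENNReal.ofReal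
        |M.μ x - N.μ (diskMobius (u (φ n)).2.1 (u (φ n)).2.2 x)| ∂hypVol) atTop (𝓝 0) :=
      tendsto_of_tendsto_of_tendsto_of_le_of_le tendsto_const_nhds
        (ENNReal.tendsto_inv_nat_nhds_zero.comp hφ.tendsto_atTop) (fun n => zero_le)
        fun n => (hu5 (φ n)).le
    rw [eq_of_tendsto_lintegral ha1 hz hlim hint hy'
      (by rw [← norm_diskMobius_apply_apply hm hz hy', hmy]; exact hyR), hmy]

/-! ### Rigidity of matchings under single fittability -/

lemma isPathConnected_ball_diff_singleton {c p : ℂ} {r : ℝ} (hr : 0 < r) :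
    IsPathConnected (ball c r \ {p}) := by
  by_cases hp : p ∈ ball c r
  · set e := OpenPartialHomeomorph.univBall c r
    have hs : e.source = univ := OpenPartialHomeomorph.univBall_source c r
    have ht : e.target = ball c r := OpenPartialHomeomorph.univBall_target c hr
    have hcon : IsPathConnected ({e.symm p}ᶜ : Set ℂ) :=
      isPathConnected_compl_singleton_of_one_lt_rank (by simp [Complex.rank_real_complex]) _
    have himg : e '' {e.symm p}ᶜ = ball c r \ {p} := by
      rw [compl_eq_univ_sdiff, ← hs, (hs ▸ e.injOn : InjOn e e.source).image_sdiff_subset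
        (by simp [hs]), e.image_source_eq_target, ht, image_singleton,
        e.right_inv (by rwa [ht])]
    rw [← himg]
    exact hcon.image (OpenPartialHomeomorph.continuous_univBall c r)
  · rw [sdiff_singleton_eq_self hp]
    exact isPathConnected_ball hr

namespace DiskSurface

lemma IsPatch.image {m : ℂ → ℂ} (hm : m ∈ diskMobiusGroup) {U : Set ℂ} (hU : IsPatch U) :
    IsPatch (m '' U) := by
  obtain ⟨m', hm', hl, hr⟩ := exists_inverse_of_mem hm
  have h := isHyperbolicIsometry_of_mem hm
  have h' := isHyperbolicIsometry_of_mem hm'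
  refine ⟨(image_mono hU.1).trans h.mapsTo.image_subset, ?_,
    hU.2.2.image' (h.differentiableOn.continuousOn.mono hU.1)⟩
  have : m '' U = ball 0 1 ∩ m' ⁻¹' U := by
    ext y
    constructor
    · rintro ⟨x, hx, rfl⟩
      exact ⟨h.mapsTo (hU.1 hx), by rwa [mem_preimage, hl (hU.1 hx)]⟩
    · rintro ⟨hy, hyU⟩
      exact ⟨m' y, hyU, hr hy⟩
  rw [this]
  exact h'.differentiableOn.continuousOn.isOpen_inter_preimage isOpen_ball hU.2.1

/-- Two Möbius transformations that match a large patch of one surface with parts of a singly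
fittable surface have the same image of this patch. -/
lemma SinglyFittable.image_eq_image {M N : DiskSurface} {A : ℝ} (hA : M.SinglyFittable A)
    {m₁ m₂ : ℂ → ℂ} (h₁ : m₁ ∈ diskMobiusGroup) (h₂ : m₂ ∈ diskMobiusGroup) {U : Set ℂ}
    (hU : IsPatch U) (hUA : ENNReal.ofReal A < N.area U) (e₁ : ∀ z ∈ U, M.μ (m₁ z) = N.μ z)
    (e₂ : ∀ z ∈ U, M.μ (m₂ z) = N.μ z) : m₁ '' U = m₂ '' U := by
  by_contra hne
  obtain ⟨m', hm', hl, -⟩ := exists_inverse_of_mem h₁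
  have hf := (isHyperbolicIsometry_of_mem h₂).comp (isHyperbolicIsometry_of_mem hm')
  have himg : (m₂ ∘ m') '' (m₁ '' U) = m₂ '' U := by
    rw [← image_comp]
    refine image_congr fun x hx => ?_
    simp only [Function.comp_apply, hl (hU.1 hx)]
  have hsub := (IsPatch.image h₁ hU).1
  refine hA ⟨m₁ '' U, m₂ '' U, m₂ ∘ m', IsPatch.image h₁ hU, IsPatch.image h₂ hU, ?_, ?_, hne, ?_⟩
  · rwa [area_image (isHyperbolicIsometry_of_mem h₁) hU.2.1.measurableSet hU.1
      ((injOn_of_mem h₁).mono hU.1) e₁]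
  · rwa [area_image (isHyperbolicIsometry_of_mem h₂) hU.2.1.measurableSet hU.1
      ((injOn_of_mem h₂).mono hU.1) e₂]
  · rw [← himg]
    refine isIsometryOn_image hf hsub (((injOn_of_mem h₂).comp (injOn_of_mem hm')
      (isHyperbolicIsometry_of_mem hm').mapsTo).mono hsub) ?_
    rintro _ ⟨x, hx, rfl⟩
    rw [Function.comp_apply, hl (hU.1 hx), e₁ x hx, e₂ x hx]

/-- Two Möbius transformations that match a large disk of one surface with parts of a singly
fittable surface agree. -/
lemma SinglyFittable.eqOn {M N : DiskSurface} {A : ℝ} (hA : M.SinglyFittable A)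
    {m₁ m₂ : ℂ → ℂ} (h₁ : m₁ ∈ diskMobiusGroup) (h₂ : m₂ ∈ diskMobiusGroup) {c : ℂ} {r : ℝ}
    (hr : 0 < r) (hb : ball c r ⊆ ball 0 1) (hUA : ENNReal.ofReal A < N.area (ball c r))
    (e₁ : ∀ z ∈ ball c r, M.μ (m₁ z) = N.μ z) (e₂ : ∀ z ∈ ball c r, M.μ (m₂ z) = N.μ z) :
    EqOn m₁ m₂ (ball 0 1) := by
  have hB := hA.image_eq_image h₁ h₂ ⟨hb, isOpen_ball, isPathConnected_ball hr⟩ hUA e₁ e₂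
  have key : ∀ p ∈ ball c r, m₁ p = m₂ p := by
    intro p hp
    have hdiff : ball c r \ {p} ⊆ ball c r := sdiff_subset
    have hnull : N.area {p} = 0 := by
      rw [N.area_apply (measurableSet_singleton p) (singleton_subset_iff.2 (hb hp)),
        setLIntegral_measure_zero _ _ (by simp)]
    -- The punctured ball is a patch of the same area. If `m₁ p = m₂ q` with `q ≠ p`, this value
    -- also lies in the `m₁`-image of the punctured ball, against injectivity.
    have hP := hA.image_eq_image h₁ h₂
      ⟨hdiff.trans hb, isOpen_ball.sdiff isClosed_singleton,
        isPathConnected_ball_diff_singleton hr⟩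
      (by rwa [measure_sdiff_null hnull]) (fun z hz => e₁ z (hdiff hz)) (fun z hz => e₂ z (hdiff hz))
    obtain ⟨q, hq, hqp⟩ : m₁ p ∈ m₂ '' ball c r := hB ▸ mem_image_of_mem m₁ hp
    by_cases hqe : q = p
    · rw [← hqp, hqe]
    · obtain ⟨x, hx, hxq⟩ : m₂ q ∈ m₁ '' (ball c r \ {p}) := hP ▸ mem_image_of_mem m₂ ⟨hq, hqe⟩
      exact absurd (injOn_of_mem h₁ (hb hx.1) (hb hp) (hxq.trans hqp)) hx.2
  have hc := mem_ball_self (x := c) hr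
  exact ((isHyperbolicIsometry_of_mem h₁).differentiableOn.analyticOnNhd
    isOpen_ball).eqOn_of_preconnected_of_eventuallyEq
    ((isHyperbolicIsometry_of_mem h₂).differentiableOn.analyticOnNhd isOpen_ball)
    (convex_ball _ _).isPreconnected (hb hc)
    (eventually_of_mem (isOpen_ball.mem_nhds hc) key)

/-! ### Gluing the local matchings -/

lemma exists_matching_ball {R : ℝ} (hR : 0 < Real.tanh R) {t : ℝ} (ht : t < 1) {M N : DiskSurface}
    (h : confWassersteinDist R M N = 0) {w : ℂ} (hw : w ∈ closedBall (0 : ℂ) t) :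
    ∃ m ∈ diskMobiusGroup, ∀ y ∈ ball w (Real.tanh R * (1 - t) / 4) ∩ ball 0 1,
      M.μ (m y) = N.μ y := by
  have hR1 := Real.tanh_lt_one R
  rw [mem_closedBall_zero_iff] at hw
  have hpos : 0 < Real.tanh R * (1 - t) := mul_pos hR (by linarith)
  have hle : Real.tanh R * (1 - t) ≤ 1 - t := by nlinarith
  have hbd : ∀ y ∈ closedBall w (Real.tanh R * (1 - t) / 8),
      ‖y‖ ≤ t + Real.tanh R * (1 - t) / 8 := fun y hy => by
    have := norm_sub_norm_le y w
    rw [mem_closedBall_iff_norm] at hy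
    linarith
  obtain ⟨w', hw', m, hm, heq⟩ := exists_matching h
    (r := Real.tanh R * (1 - t) / 8) (by linarith) fun y hy => by
      have := hbd y hy
      rw [mem_ball_zero_iff]
      linarith
  refine ⟨m, hm, fun y hy => heq y (mem_ball_zero_iff.1 hy.2) ?_⟩
  have h1 := hbd w' hw'
  have hy1 := mem_ball_zero_iff.1 hy.2
  have hy2 := hy.1
  rw [mem_ball_iff_norm] at hy2
  rw [mem_closedBall_iff_norm, norm_sub_rev] at hw'
  have h2 : ‖y - w'‖ ≤ ‖y - w‖ + ‖w - w'‖ := norm_sub_le_norm_sub_add_norm_sub _ _ _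
  -- With `T = tanh R`, the denominator is at least `7/8 * (1 - t)` and the numerator is below `3/8
  -- * T * (1 - t)`, so the quotient stays below `T`.
  have h3 : 1 - ‖w'‖ ≤ ‖1 - conj w' * y‖ := by
    have h4 := norm_sub_norm_le 1 (conj w' * y)
    rw [norm_one, norm_mul, Complex.norm_conj] at h4
    nlinarith [norm_nonneg w']
  rw [norm_diskMobius, div_lt_iff₀ (by linarith)]
  nlinarith

/-- For surfaces at distance zero there is one Möbius transformation that matches the conformal
factors on a whole disk around the origin, provided that the first surface is singly fittable with a
threshold that depends only on a lower bound of the second conformal factor. -/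
lemma exists_matching_closedBall {R : ℝ} (hR : 0 < Real.tanh R) {t ε c : ℝ} (ht : 0 < t)
    (ht1 : t < 1) (hε : 0 < ε) (hεt : ε ≤ t) (hεR : 2 * ε ≤ Real.tanh R * (1 - t) / 4)
    (hc : 0 < c) {M N : DiskSurface} (h : confWassersteinDist R M N = 0)
    (hcN : ∀ z ∈ closedBall (0 : ℂ) t, c ≤ N.μ z) :
    ∃ m ∈ diskMobiusGroup, M.SinglyFittable (c * (ε / 2) ^ 2) →
      ∀ z ∈ closedBall (0 : ℂ) t, M.μ (m z) = N.μ z := by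
  have hK : closedBall (0 : ℂ) t ⊆ ball 0 1 := closedBall_subset_ball ht1
  choose! F hF hFeq using fun w (hw : w ∈ closedBall (0 : ℂ) t) =>
    exists_matching_ball hR ht1 h hw
  have h0 : (0 : ℂ) ∈ closedBall (0 : ℂ) t := mem_closedBall_self ht.le
  refine ⟨F 0, hF 0 h0, fun hA => ?_⟩
  have hnear : ∀ w ∈ closedBall (0 : ℂ) t, ∀ w' ∈ closedBall (0 : ℂ) t, ‖w - w'‖ < ε →
      EqOn (F w) (F w') (ball 0 1) := by
    intro w hw w' hw' hd
    -- Moving `w` towards the origin by at most `ε / 2` puts the ball of radius `ε / 2` around `p`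
    -- inside the closed disk, within `ε` of `w` and `2 * ε` of `w'`, where both matchings hold.
    set p : ℂ := ((1 - ε / (2 * t) : ℝ) : ℂ) * w with hp
    have hq : 0 ≤ ε / (2 * t) := by positivity
    have hq1 : ε / (2 * t) ≤ 1 := by rw [div_le_one (by positivity)]; linarith
    have hqt : ε / (2 * t) * t = ε / 2 := by field_simp
    have hwt := mem_closedBall_zero_iff.1 hw
    have hpw : ‖p - w‖ ≤ ε / 2 := by
      have : p - w = ((-(ε / (2 * t)) : ℝ) : ℂ) * w := by rw [hp]; push_cast; ring
      rw [this, norm_mul, Complex.norm_real, norm_neg, Real.norm_of_nonneg hq, ← hqt]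
      gcongr
    have hp0 : ‖p‖ ≤ t - ε / 2 := by
      rw [hp, norm_mul, Complex.norm_real, Real.norm_of_nonneg (by linarith), ← hqt]
      nlinarith
    have hB0 : ball p (ε / 2) ⊆ closedBall 0 t := fun y hy => by
      rw [mem_ball_iff_norm] at hy
      rw [mem_closedBall_zero_iff]
      linarith [norm_sub_norm_le y p]
    have hBw : ∀ y ∈ ball p (ε / 2), ‖y - w‖ < ε := fun y hy => by
      rw [mem_ball_iff_norm] at hy
      linarith [norm_sub_le_norm_sub_add_norm_sub y p w]
    refine hA.eqOn (N := N) (hF w hw) (hF w' hw') (half_pos hε) (hB0.trans hK) ?_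
      (fun z hz => hFeq w hw z ⟨?_, hK (hB0 hz)⟩) (fun z hz => hFeq w' hw' z ⟨?_, hK (hB0 hz)⟩)
    -- The area is at least `c * π * (ε / 2) ^ 2`; the factor `π > 1` makes the inequality with the
    -- threshold strict.
    · refine lt_of_lt_of_le ?_ (N.ofReal_mul_volume_le_area measurableSet_ball (hB0.trans hK)
        fun z hz => hcN z (hB0 hz))
      have hpi : (NNReal.pi : ENNReal) = ENNReal.ofReal Real.pi := by
        rw [← NNReal.coe_real_pi, ENNReal.ofReal_coe_nnreal]
      rw [Complex.volume_ball, hpi, ← ENNReal.ofReal_pow (by positivity),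
        ← ENNReal.ofReal_mul (by positivity), ← ENNReal.ofReal_mul hc.le,
        ENNReal.ofReal_lt_ofReal_iff (by positivity)]
      have : 0 < c * (ε / 2) ^ 2 := by positivity
      nlinarith [Real.pi_gt_three]
    · rw [mem_ball_iff_norm]
      linarith [hBw z hz]
    · rw [mem_ball_iff_norm]
      linarith [hBw z hz, norm_sub_le_norm_sub_add_norm_sub z w w']
  -- The choice `F` is locally constant as a map on the disk, hence constant on the connected closed
  -- disk.
  have hall : ∀ w ∈ closedBall (0 : ℂ) t, EqOn (F 0) (F w) (ball 0 1) := fun w hw =>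
    (convex_closedBall (0 : ℂ) t).isPreconnected.induction₂
      (fun x y => EqOn (F x) (F y) (ball 0 1))
      (fun x hx => by
        filter_upwards [self_mem_nhdsWithin, mem_nhdsWithin_of_mem_nhds (ball_mem_nhds x hε)]
          with y hy hyx
        exact hnear x hx y hy (by rwa [mem_ball_iff_norm, norm_sub_rev] at hyx))
      (fun _ _ _ _ _ _ h1 h2 => h1.trans h2) (fun _ _ _ _ h => h.symm) h0 hw
  intro z hz
  rw [hall z hz (hK hz)]
  exact hFeq z hz z ⟨mem_ball_self (by linarith), hK hz⟩

end DiskSurface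

/-! ### The theorem -/

lemma tanh_pos_of_pos {x : ℝ} (hx : 0 < x) : 0 < Real.tanh x := by
  rw [Real.tanh_eq_sinh_div_cosh]
  exact div_pos (Real.sinh_pos_iff.2 hx) (Real.cosh_pos x)

lemma hypDisk_zero (ρ : ℝ) : hypDisk 0 ρ = closedBall 0 (Real.tanh ρ) := by
  ext z
  simp only [hypDisk, diskMobius, mem_ofPred_eq, mem_closedBall_zero_iff, Complex.ofReal_zero,
    zero_mul, Complex.exp_zero, map_zero, sub_zero, div_one, one_mul, and_iff_right_iff_imp]
  exact fun h => h.trans_lt (Real.tanh_lt_one ρ)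

theorem mainTheorem7 (R : ℝ) (hR : 0 < R) (ρ : ℝ) (hρ : 0 < ρ) :
    -- for each pair of surfaces there are a Möbius transformation and an area threshold
    (∀ M N : DiskSurface, DiskSurface.confWassersteinDist R M N = 0 →
      ∃ m ∈ diskMobiusGroup, ∃ A : ℝ, 0 < A ∧
        (M.SinglyFittable A → N.SinglyFittable A →
          (∀ z ∈ hypDisk 0 ρ, M.μ (m z) = N.μ z) ∧
          N.IsIsometryOn M m (interior (hypDisk 0 ρ)) (m '' interior (hypDisk 0 ρ)))) ∧
    -- the threshold depends only on `R`, `ρ` and a lower bound of the conformal factor on the disk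
    (∀ c : ℝ, 0 < c → ∃ A : ℝ, 0 < A ∧
      ∀ M N : DiskSurface, DiskSurface.confWassersteinDist R M N = 0 →
        (∀ z ∈ hypDisk 0 ρ, c ≤ N.μ z) →
        ∃ m ∈ diskMobiusGroup,
          (M.SinglyFittable A → N.SinglyFittable A →
            (∀ z ∈ hypDisk 0 ρ, M.μ (m z) = N.μ z) ∧
            N.IsIsometryOn M m (interior (hypDisk 0 ρ)) (m '' interior (hypDisk 0 ρ)))) := by
  have hT := tanh_pos_of_pos hR
  have ht := tanh_pos_of_pos hρ
  have ht1 := Real.tanh_lt_one ρ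
  have hK : closedBall (0 : ℂ) (Real.tanh ρ) ⊆ ball 0 1 := closedBall_subset_ball ht1
  have huniform : ∀ c : ℝ, 0 < c → ∃ A : ℝ, 0 < A ∧
      ∀ M N : DiskSurface, DiskSurface.confWassersteinDist R M N = 0 →
        (∀ z ∈ hypDisk 0 ρ, c ≤ N.μ z) →
        ∃ m ∈ diskMobiusGroup,
          (M.SinglyFittable A → N.SinglyFittable A →
            (∀ z ∈ hypDisk 0 ρ, M.μ (m z) = N.μ z) ∧
            N.IsIsometryOn M m (interior (hypDisk 0 ρ)) (m '' interior (hypDisk 0 ρ))) := by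
    intro c hc
    have hδ : 0 < Real.tanh R * (1 - Real.tanh ρ) / 8 :=
      div_pos (mul_pos hT (by linarith)) (by norm_num)
    obtain ⟨ε, hε, hεt, hεR⟩ : ∃ ε > 0, ε ≤ Real.tanh ρ ∧
        ε ≤ Real.tanh R * (1 - Real.tanh ρ) / 8 :=
      ⟨_, lt_min ht hδ, min_le_left _ _, min_le_right _ _⟩
    refine ⟨c * (ε / 2) ^ 2, by positivity, fun M N h hcN => ?_⟩
    rw [hypDisk_zero] at hcN ⊢
    obtain ⟨m, hm, hmatch⟩ := DiskSurface.exists_matching_closedBall hT ht ht1 hε hεt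
      (by linarith) hc h hcN
    refine ⟨m, hm, fun hA _ => ⟨hmatch hA, ?_⟩⟩
    have hint := interior_subset.trans hK
    exact DiskSurface.isIsometryOn_image (isHyperbolicIsometry_of_mem hm) hint
      ((injOn_of_mem hm).mono hint) fun z hz => hmatch hA z (interior_subset hz)
  refine ⟨fun M N h => ?_, huniform⟩
  -- Continuity on the compact disk supplies the lower bound, so part 1 follows from the uniform
  -- version.
  obtain ⟨c, hc, hcN⟩ := N.exists_pos_le (isCompact_closedBall 0 (Real.tanh ρ)) hK
  obtain ⟨A, hA, H⟩ := huniform c hc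
  obtain ⟨m, hm, hm'⟩ := H M N h (by rwa [hypDisk_zero])
  exact ⟨m, hm, A, hA, hm'⟩
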